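/- Let $\mathcal X\subseteq\mathbb R^n$ be a nonempty closed convex set contained in a closed pointed convex cone $\mathcal C$, let $c\in\operatorname{int}(\mathcal C^*)\cup\{0\}$, where $\mathcal C^*$ is the dual cone of $\mathcal C$, and let $\varepsilon\in(0,1)$. Let $\Xi\subseteq\mathbb R^m$ be a (Borel) support set, $\|\cdot\|$ a norm on $\mathbb R^m$, $\theta\ge 0$, and let $\mathbb P_{\tilde\zeta}$ be a sub-Gaussian probability distribution on $\Xi$: there are $C_1,C_2>0$ with $\mathbb P_{\tilde\zeta}\{\|\tilde\zeta\|\ge t\}\le C_1\exp(-C_2t^2)$ for all $t\ge 0$. Let $$\mathcal P_\infty^W=\{\mathbb P:\ \mathbb P\{\tilde\xi\in\Xi\}=1,\ W_\infty(\mathbb P,\mathbb P_{\tilde\zeta})\le\theta\}$$ be the $\infty$-Wasserstein ambiguity set, where $W_\infty(\mathbb P_1,\mathbb P_2)$ is the infimum, over all couplings $\mathbb Q$ of $\mathbb P_1$ and $\mathbb P_2$ on $\Xi\times\Xi$, of the $\mathbb Q$-essential supremum of $\|\xi_1-\xi_2\|$. Let $g_i:\mathbb R^n\times\Xi\to\mathbb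 R$, $i\in[I]$, $I\ge 1$, be functions such that $g_i(x,\cdot)$ is measurable for every $x$ and, for every $\mathbb P\in\mathcal P_\infty^W$ and $\mathbb P$-almost every $\xi$, $g_i(\cdot,\xi)$ is convex and lower semicontinuous. Write $r_+=\max\{r,0\}$. The optimal value of the worst-case ALSO-X is $$v_\infty^A=\inf_t\Big\{t:\ \text{there is } x^*\in\operatorname*{argmin}_{x\in\mathcal X,\ c^\top x\le t}\ \sup_{\mathbb P\in\mathcal P_\infty^W}\mathbb E_{\mathbb P}\big[\max_{i\in[I]}g_i(x,\tilde\xi)_+\big]\ \text{ with } \inf_{\mathbb P\in\mathcal P_\infty^W}\mathbb P\{\tilde\xi: g_i(x^*,\tilde\xi)\le 0\ \forall i\in[I]\}\ge 1-\varepsilon\Big\},$$ and the optimal value of the worst-case CVaR approximation is $$v_\infty^{\mathrm{CVaR}}=\inf_{x\in\mathcal X}\Big\{c^\top x:\ \sup_{\mathbb P\in\mathcal P_\infty^W}\inf_{\beta\in\mathbb R}\Big[\beta+\frac1\varepsilon\,\mathbb E_{\mathbb P}\big[\max_{i\in[I]}(g_i(x,\tilde\xi)-\beta)_+\big]\Big]\le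 0\Big\},$$ with $\inf\emptyset=+\infty$. If $c=0$, assume in addition that the lower-level problem $\min_{x\in\mathcal X}\sup_{\mathbb P\in\mathcal P_\infty^W}\mathbb E_{\mathbb P}[\max_{i}g_i(x,\tilde\xi)_+]$ has an optimal solution. Then $$v_\infty^A\le v_\infty^{\mathrm{CVaR}}.$$ -/

import Mathlib

open MeasureTheory Set
open scoped ENNReal NNReal

noncomputable section

namespace DRCCP

section Wasserstein

variable {F : Type*} [NormedAddCommGroup F] [MeasurableSpace F] {Ξ : Set F}

/-- Joint distributions on `Ξ × Ξ` with marginals `P₁` and `P₂`. -/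
def couplings (P₁ P₂ : Measure Ξ) : Set (Measure (Ξ × Ξ)) :=
  {Q | IsProbabilityMeasure Q ∧ Q.map Prod.fst = P₁ ∧ Q.map Prod.snd = P₂}

/-- The `∞`-Wasserstein distance: the infimum over all couplings `Q` of the `Q`-essential
supremum of `‖ξ₁ - ξ₂‖`. -/
def wassersteinInf (P₁ P₂ : Measure Ξ) : ℝ≥0∞ :=
  ⨅ Q ∈ couplings P₁ P₂, essSup (fun p : Ξ × Ξ => ‖(p.1 : F) - (p.2 : F)‖ₑ) Q

/-- The `∞`-Wasserstein ambiguity set: all probability distributions on `Ξ` at `∞`-Wasserstein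
distance at most `θ` from the reference distribution `μ`. -/
def ambiguitySet (μ : Measure Ξ) (θ : ℝ≥0) : Set (Measure Ξ) :=
  {P | IsProbabilityMeasure P ∧ wassersteinInf P μ ≤ θ}

/-- Sub-Gaussian tail bound. -/
def IsSubGaussian (μ : Measure Ξ) : Prop :=
  ∃ C₁ > (0 : ℝ), ∃ C₂ > (0 : ℝ), ∀ t : ℝ, 0 ≤ t →
    μ.real {ζ | t ≤ ‖(ζ : F)‖} ≤ C₁ * Real.exp (-C₂ * t ^ 2)

end Wasserstein

section Programs

variable {n : ℕ} {S ι : Type*} [MeasurableSpace S]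

/-- The worst-case hinge loss `sup_P E_P[max_i (g_i(x, ξ))_+]`, a value in `[0, ∞]`.
Note that `ENNReal.ofReal r` is the positive part of `r`. -/
def worstHinge (g : ι → EuclideanSpace ℝ (Fin n) → S → ℝ) (𝒜 : Set (Measure S))
    (x : EuclideanSpace ℝ (Fin n)) : ℝ≥0∞ :=
  ⨆ P ∈ 𝒜, ∫⁻ ξ, ⨆ i, ENNReal.ofReal (g i x ξ) ∂P

/-- The optimal solutions of the worst-case hinge-loss approximation
`min {sup_P E_P[max_i (g_i(x, ξ))_+] : x ∈ X, cᵀx ≤ t}`. -/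
def hingeArgmin (g : ι → EuclideanSpace ℝ (Fin n) → S → ℝ) (𝒜 : Set (Measure S))
    (X : Set (EuclideanSpace ℝ (Fin n))) (c : EuclideanSpace ℝ (Fin n)) (t : ℝ) :
    Set (EuclideanSpace ℝ (Fin n)) :=
  {x | x ∈ X ∧ inner ℝ c x ≤ t ∧
    ∀ y ∈ X, inner ℝ c y ≤ t → worstHinge g 𝒜 x ≤ worstHinge g 𝒜 y}

/-- The distributionally robust chance constraint
`inf_P P{ξ : g_i(x, ξ) ≤ 0 for all i} ≥ 1 - ε`. -/
def RobustChance (g : ι → EuclideanSpace ℝ (Fin n) → S → ℝ) (𝒜 : Set (Measure S)) (ε : ℝ)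
    (x : EuclideanSpace ℝ (Fin n)) : Prop :=
  ENNReal.ofReal (1 - ε) ≤ ⨅ P ∈ 𝒜, P {ξ | ∀ i, g i x ξ ≤ 0}

/-- The optimal value of the worst-case ALSO-X: the infimum of those `t` for which the worst-case
hinge-loss approximation with objective bound `t` has an optimal solution satisfying the
distributionally robust chance constraint; it is `⊤` if there is no such `t`. -/
def worstALSOX (g : ι → EuclideanSpace ℝ (Fin n) → S → ℝ) (𝒜 : Set (Measure S))
    (X : Set (EuclideanSpace ℝ (Fin n))) (c : EuclideanSpace ℝ (Fin n)) (ε : ℝ) : EReal :=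
  ⨅ (t : ℝ) (_ : ∃ x ∈ hingeArgmin g 𝒜 X c t, RobustChance g 𝒜 ε x), (t : EReal)

/-- The worst-case conditional value-at-risk
`sup_P inf_β [β + ε⁻¹ E_P[max_i (g_i(x, ξ) - β)_+]]`. -/
def worstCVaR (g : ι → EuclideanSpace ℝ (Fin n) → S → ℝ) (𝒜 : Set (Measure S)) (ε : ℝ)
    (x : EuclideanSpace ℝ (Fin n)) : EReal :=
  ⨆ P ∈ 𝒜, ⨅ β : ℝ, (β : EReal) +
    ((ENNReal.ofReal (1 / ε) * ∫⁻ ξ, ⨆ i, ENNReal.ofReal (g i x ξ - β) ∂P : ℝ≥0∞) : EReal)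

/-- The optimal value of the worst-case CVaR approximation: the infimum of `cᵀx` over the `x ∈ X`
whose worst-case conditional value-at-risk is nonpositive; it is `⊤` if there is no such `x`. -/
def worstCVaRValue (g : ι → EuclideanSpace ℝ (Fin n) → S → ℝ) (𝒜 : Set (Measure S))
    (X : Set (EuclideanSpace ℝ (Fin n))) (c : EuclideanSpace ℝ (Fin n)) (ε : ℝ) : EReal :=
  ⨅ (x ∈ X) (_ : worstCVaR g 𝒜 ε x ≤ 0), ((inner ℝ c x : ℝ) : EReal)

end Programs

end DRCCP

end

/-!
The value `cᵀy` of every `y` feasible for the worst-case `CVaR` approximation is an admissible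
bound `t` in the worst-case ALSO-X: the hinge-loss problem with `cᵀx ≤ cᵀy` has a solution, and
*every* solution `x` satisfies the robust chance constraint.

Existence (`hingeArgmin_nonempty`) holds because the worst-case hinge loss is lower semicontinuous
by Fatou's lemma, while a cost vector interior to the dual cone has compact sublevel sets on `X`;
for `c = 0` the bound `t = 0` is vacuous and existence is assumed.

For the chance constraint (`robustChance_of_mem_hingeArgmin`), suppose that `x` violates the
constraints with probability above `ε` under some `P₀` in the ambiguity set. By lower
semicontinuity so does some `z = (1 - l) x + l y` with `0 < l < 1`. Choose `P₁` for which the hinge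
loss at `z` exceeds `1 - l` times the optimal worst-case hinge loss, which is possible since that
optimum is positive and finite and `z` is feasible. The ambiguity set allows gluing
(`exists_mem_ambiguitySet_dominating`): some `P` in it has at `z` both a hinge loss as large as
under `P₁` and a violation probability as large as under `P₀`. Now `CVaR` feasibility of `y` says
that the loss at `y` has a nonpositive `P`-integral over every event of probability at least `ε`
(`setLIntegral_pos_le_neg_of_cvar_nonpos`). Over the event of violation at `z`, convexity then
bounds the hinge loss at `z` under `P` by `1 - l` times the one at `x`, a contradiction.

Gluing needs couplings that attain the `∞`-Wasserstein distance; these come from Prokhorov's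
theorem (`exists_coupling_of_wassersteinInf_le`). Finiteness of the optimum uses that the ambiguity
set is closed under countable mixtures (`iSup_lintegral_ambiguitySet_lt_top`).
-/

open Filter Topology ProbabilityTheory

/-! ### The ambiguity set: attained couplings, gluing and mixtures -/

namespace DRCCP

section Wasserstein

variable {F : Type*} [NormedAddCommGroup F] [NormedSpace ℝ F] [FiniteDimensional ℝ F]
  [MeasurableSpace F] [BorelSpace F] {Ξ : Set F}

/-- `Ξ` need not be closed, hence need not be complete; tightness comes from inner regularity in the
ambient space. -/
lemma isTightMeasureSet_singleton_subtype (hΞ : MeasurableSet Ξ) (P : Measure Ξ)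
    [IsFiniteMeasure P] : IsTightMeasureSet {P} := by
  have : ProperSpace F := FiniteDimensional.proper ℝ F
  rw [isTightMeasureSet_iff_exists_isCompact_measure_compl_le]
  intro δ hδ
  obtain ⟨K, hKΞ, hK, hPK⟩ := hΞ.exists_isCompact_sdiff_lt
    (μ := P.map Subtype.val) (measure_ne_top _ _) hδ.ne'
  refine ⟨Subtype.val ⁻¹' K, IsInducing.subtypeVal.isCompact_preimage' hK (by simpa using hKΞ),
    fun ν hν => ?_⟩
  rw [mem_singleton_iff.1 hν]
  rw [Measure.map_apply measurable_subtype_coe (hΞ.diff hK.measurableSet)] at hPK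
  refine le_trans (measure_mono fun ξ hξ => ?_) hPK.le
  exact ⟨ξ.2, hξ⟩

/-- The infimum defining the `∞`-Wasserstein distance is attained: couplings of two fixed
distributions form a tight set, and by the portmanteau theorem a weak limit of couplings keeps the
distance bounds. -/
lemma exists_coupling_of_wassersteinInf_le (hΞ : MeasurableSet Ξ) {P μ : Measure Ξ}
    [IsProbabilityMeasure P] [IsProbabilityMeasure μ] {θ : ℝ≥0} (h : wassersteinInf P μ ≤ θ) :
    ∃ Q ∈ couplings P μ, ∀ᵐ p ∂Q, ‖(p.1 : F) - (p.2 : F)‖ₑ ≤ θ := by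
  have : ProperSpace F := FiniteDimensional.proper ℝ F
  have hdist : Continuous (fun p : Ξ × Ξ => ‖(p.1 : F) - (p.2 : F)‖ₑ) := by fun_prop
  set r : ℕ → ℝ≥0∞ := fun k => θ + (k + 1 : ℝ≥0∞)⁻¹ with hr
  have hr_anti : Antitone r := fun i j hij => by
    simp only [hr]; gcongr
  have hr_lim : ∀ a : ℝ≥0∞, (∀ k, a ≤ r k) → a ≤ θ := by
    intro a ha
    refine ge_of_tendsto' (x := atTop) (f := r) ?_ ha
    have h0 : Tendsto (fun k : ℕ => ((k : ℝ≥0∞) + 1)⁻¹) atTop (𝓝 0) := by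
      have := (tendsto_add_atTop_iff_nat 1).2 ENNReal.tendsto_inv_nat_nhds_zero
      simpa using this
    simpa [hr] using (tendsto_const_nhds (x := (θ : ℝ≥0∞))).add h0
  have hex : ∀ k, ∃ Q : ProbabilityMeasure (Ξ × Ξ), (Q : Measure (Ξ × Ξ)) ∈ couplings P μ ∧
      ∀ᵐ p ∂(Q : Measure (Ξ × Ξ)), ‖(p.1 : F) - (p.2 : F)‖ₑ ≤ r k := by
    intro k
    have hlt : wassersteinInf P μ < r k := by
      refine h.trans_lt (ENNReal.lt_add_right ENNReal.coe_ne_top ?_)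
      simp
    simp only [wassersteinInf, iInf_lt_iff] at hlt
    obtain ⟨Q, hQ, hQk⟩ := hlt
    refine ⟨⟨Q, hQ.1⟩, hQ, ?_⟩
    filter_upwards [ENNReal.ae_le_essSup (μ := Q)
      (fun p : Ξ × Ξ => ‖(p.1 : F) - (p.2 : F)‖ₑ)] with p hp
    exact hp.trans hQk.le
  choose Q hQ hQr using hex
  set S : Set (ProbabilityMeasure (Ξ × Ξ)) := {ν | (ν : Measure (Ξ × Ξ)) ∈ couplings P μ}
  have hS : IsTightMeasureSet {((ν : ProbabilityMeasure (Ξ × Ξ)) : Measure (Ξ × Ξ)) | ν ∈ S} := by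
    refine IsTightMeasureSet.prodMk ((isTightMeasureSet_singleton_subtype hΞ P).subset ?_)
      ((isTightMeasureSet_singleton_subtype hΞ μ).subset ?_)
    · rintro _ ⟨_, ⟨ν, hν, rfl⟩, rfl⟩
      exact hν.2.1
    · rintro _ ⟨_, ⟨ν, hν, rfl⟩, rfl⟩
      exact hν.2.2
  obtain ⟨R, -, φ, hφ, hlim⟩ := (isCompact_closure_of_isTightMeasureSet hS).isSeqCompact
    (fun k => subset_closure (hQ k))
  -- marginals pass to the weak limit `R`
  have hmarg : ∀ {f : Ξ × Ξ → Ξ} (hf : Continuous f) (ν : Measure Ξ) [IsProbabilityMeasure ν],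
      (∀ k, (Q k : Measure (Ξ × Ξ)).map f = ν) → (R : Measure (Ξ × Ξ)).map f = ν := by
    intro f hf ν _ hν
    have h1 := ProbabilityMeasure.tendsto_map_of_tendsto_of_continuous _ _ hlim hf
    have h2 : (fun k => ((Q ∘ φ) k).map hf.measurable.aemeasurable)
        = fun _ => (⟨ν, inferInstance⟩ : ProbabilityMeasure Ξ) := by
      funext k
      exact Subtype.ext (hν (φ k))
    rw [h2] at h1
    have h3 : R.map hf.measurable.aemeasurable = ⟨ν, inferInstance⟩ :=
      tendsto_nhds_unique h1 tendsto_const_nhds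
    exact congrArg Subtype.val h3
  refine ⟨R, ⟨inferInstance, hmarg continuous_fst P fun k => (hQ k).2.1,
    hmarg continuous_snd μ fun k => (hQ k).2.2⟩, ?_⟩
  have hclose : ∀ m, ∀ᵐ p ∂(R : Measure (Ξ × Ξ)), ‖(p.1 : F) - (p.2 : F)‖ₑ ≤ r m := by
    intro m
    have hcl : IsClosed {p : Ξ × Ξ | ‖(p.1 : F) - (p.2 : F)‖ₑ ≤ r m} :=
      isClosed_le hdist continuous_const
    have hls := ProbabilityMeasure.limsup_measure_closed_le_of_tendsto hlim hcl
    have hone : ∀ᶠ k in atTop, ((Q ∘ φ) k : Measure (Ξ × Ξ))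
        {p : Ξ × Ξ | ‖(p.1 : F) - (p.2 : F)‖ₑ ≤ r m} = 1 := by
      filter_upwards [eventually_ge_atTop m] with k hk
      refine (prob_compl_eq_zero_iff hcl.measurableSet).1 ?_
      refine ae_iff.1 ((hQr (φ k)).mono fun p hp => ?_)
      exact hp.trans (hr_anti (hk.trans (hφ.le_apply)))
    rw [limsup_congr hone, limsup_const] at hls
    exact ae_iff.2 ((prob_compl_eq_zero_iff hcl.measurableSet).2 (le_antisymm prob_le_one hls))
  filter_upwards [ae_all_iff.2 hclose] with p hp
  exact hr_lim _ hp

lemma mem_ambiguitySet_iff (hΞ : MeasurableSet Ξ) {P μ : Measure Ξ} [IsProbabilityMeasure μ]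
    {θ : ℝ≥0} : P ∈ ambiguitySet μ θ ↔
      ∃ Q ∈ couplings P μ, ∀ᵐ p ∂Q, ‖(p.1 : F) - (p.2 : F)‖ₑ ≤ θ := by
  constructor
  · rintro ⟨hP, hW⟩
    exact exists_coupling_of_wassersteinInf_le hΞ hW
  · rintro ⟨Q, hQ, hQθ⟩
    have := hQ.1
    refine ⟨hQ.2.1 ▸ Measure.isProbabilityMeasure_map measurable_fst.aemeasurable, ?_⟩
    exact iInf₂_le_of_le Q hQ (essSup_le_of_ae_le _ hQθ)

/-- Gluing: for `P₁`, `P₂` in the ambiguity set and a loss `h`, some `P` in the ambiguity set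
makes `h` stochastically at least as large as both of them do. Couple `P₁` and `P₂` with the
reference distribution independently given the reference point, and let `P` be the law of whichever
of the two perturbed points has the larger loss. -/
lemma exists_mem_ambiguitySet_dominating (hΞ : MeasurableSet Ξ) {μ P₁ P₂ : Measure Ξ}
    [IsProbabilityMeasure μ] {θ : ℝ≥0} (h₁ : P₁ ∈ ambiguitySet μ θ) (h₂ : P₂ ∈ ambiguitySet μ θ)
    {h : Ξ → ℝ} (hh : Measurable h) :
    ∃ P ∈ ambiguitySet μ θ, ∀ φ : ℝ → ℝ≥0∞, Monotone φ →
      ∫⁻ ξ, φ (h ξ) ∂P₁ ≤ ∫⁻ ξ, φ (h ξ) ∂P ∧ ∫⁻ ξ, φ (h ξ) ∂P₂ ≤ ∫⁻ ξ, φ (h ξ) ∂P := by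
  have : StandardBorelSpace Ξ := hΞ.standardBorel
  have hdist : Measurable (fun p : Ξ × Ξ => ‖(p.1 : F) - (p.2 : F)‖ₑ) := by fun_prop
  -- disintegrate a coupling of `P` with `μ` along the reference point
  have hkernel : ∀ P ∈ ambiguitySet μ θ, ∃ κ : Kernel Ξ Ξ, IsMarkovKernel κ ∧
      (μ ⊗ₘ κ).map Prod.snd = P ∧ ∀ᵐ p ∂(μ ⊗ₘ κ), ‖(p.2 : F) - (p.1 : F)‖ₑ ≤ θ := by
    intro P hP
    obtain ⟨Q, hQ, hQθ⟩ := (mem_ambiguitySet_iff hΞ).1 hP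
    have := hQ.1
    have : Nonempty Ξ := (nonempty_of_isProbabilityMeasure Q).map Prod.fst
    have hprob : IsProbabilityMeasure (Q.map Prod.swap) :=
      Measure.isProbabilityMeasure_map measurable_swap.aemeasurable
    have hfst : (Q.map Prod.swap).fst = μ := by
      rw [Measure.fst_map_swap]; exact hQ.2.2
    have hdis : μ ⊗ₘ (Q.map Prod.swap).condKernel = Q.map Prod.swap := by
      conv_lhs => rw [← hfst]
      exact (Q.map Prod.swap).disintegrate _
    refine ⟨(Q.map Prod.swap).condKernel, inferInstance, ?_, ?_⟩
    · rw [hdis]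
      exact Measure.snd_map_swap.trans hQ.2.1
    · rw [hdis, ae_map_iff measurable_swap.aemeasurable
        (measurableSet_le (by fun_prop) measurable_const)]
      exact hQθ
  obtain ⟨κ₁, _, hκ₁, hκ₁θ⟩ := hkernel P₁ h₁
  obtain ⟨κ₂, _, hκ₂, hκ₂θ⟩ := hkernel P₂ h₂
  set ρ : Measure (Ξ × Ξ × Ξ) := μ ⊗ₘ (κ₁ ×ₖ κ₂) with hρ
  have hρ₁ : ρ.map (fun z => (z.1, z.2.1)) = μ ⊗ₘ κ₁ := by
    conv_rhs => rw [← Kernel.fst_prod κ₁ κ₂, Kernel.fst_eq, Measure.compProd_map measurable_fst]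
    rfl
  have hρ₂ : ρ.map (fun z => (z.1, z.2.2)) = μ ⊗ₘ κ₂ := by
    conv_rhs => rw [← Kernel.snd_prod κ₁ κ₂, Kernel.snd_eq, Measure.compProd_map measurable_snd]
    rfl
  have hm₁ : Measurable (fun z : Ξ × Ξ × Ξ => (z.1, z.2.1)) := by fun_prop
  have hm₂ : Measurable (fun z : Ξ × Ξ × Ξ => (z.1, z.2.2)) := by fun_prop
  set T : Ξ × Ξ × Ξ → Ξ := fun z => if h z.2.2 ≤ h z.2.1 then z.2.1 else z.2.2 with hT
  have hTm : Measurable T := by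
    refine Measurable.ite (measurableSet_le ?_ ?_) ?_ ?_ <;> fun_prop
  have hTρ : ∀ f : Ξ → ℝ≥0∞, Measurable f → ∫⁻ ξ, f ξ ∂(ρ.map T) = ∫⁻ z, f (T z) ∂ρ :=
    fun f hf => lintegral_map hf hTm
  refine ⟨ρ.map T, (mem_ambiguitySet_iff hΞ).2 ⟨ρ.map (fun z => (T z, z.1)), ⟨?_, ?_, ?_⟩, ?_⟩, ?_⟩
  · exact Measure.isProbabilityMeasure_map (by fun_prop)
  · rw [Measure.map_map measurable_fst (by fun_prop)]
    rfl
  · rw [Measure.map_map measurable_snd (by fun_prop)]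
    exact Measure.fst_compProd μ (κ₁ ×ₖ κ₂)
  · rw [ae_map_iff (by fun_prop) (measurableSet_le hdist measurable_const)]
    rw [← hρ₁, ae_map_iff hm₁.aemeasurable (measurableSet_le (by fun_prop) measurable_const)]
      at hκ₁θ
    rw [← hρ₂, ae_map_iff hm₂.aemeasurable (measurableSet_le (by fun_prop) measurable_const)]
      at hκ₂θ
    filter_upwards [hκ₁θ, hκ₂θ] with z hz₁ hz₂
    simp only [hT]
    split_ifs
    exacts [hz₁, hz₂]
  · intro φ hφ
    have hφh : Measurable fun ξ => φ (h ξ) := hφ.measurable.comp hh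
    rw [hTρ _ hφh]
    constructor
    · rw [← hκ₁, ← hρ₁, Measure.map_map measurable_snd hm₁, lintegral_map hφh (by fun_prop)]
      refine lintegral_mono fun z => hφ ?_
      simp only [hT, Function.comp]
      split_ifs with hz
      exacts [le_rfl, (not_le.1 hz).le]
    · rw [← hκ₂, ← hρ₂, Measure.map_map measurable_snd hm₂, lintegral_map hφh (by fun_prop)]
      refine lintegral_mono fun z => hφ ?_
      simp only [hT, Function.comp]
      split_ifs with hz
      exacts [hz, le_rfl]

/-- Countable mixtures stay in the ambiguity set: mix the couplings with the same weights. -/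
lemma sum_smul_mem_ambiguitySet (hΞ : MeasurableSet Ξ) {μ : Measure Ξ} [IsProbabilityMeasure μ]
    {θ : ℝ≥0} {P : ℕ → Measure Ξ} (hP : ∀ k, P k ∈ ambiguitySet μ θ) {w : ℕ → ℝ≥0∞}
    (hw : ∑' k, w k = 1) : Measure.sum (fun k => w k • P k) ∈ ambiguitySet μ θ := by
  choose Q hQ hQθ using fun k => (mem_ambiguitySet_iff hΞ).1 (hP k)
  have hmap : ∀ f : Ξ × Ξ → Ξ, Measurable f →
      (Measure.sum fun k => w k • Q k).map f = Measure.sum fun k => w k • (Q k).map f := by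
    intro f hf
    rw [Measure.map_sum hf.aemeasurable]
    simp only [Measure.map_smul]
  refine (mem_ambiguitySet_iff hΞ).2 ⟨Measure.sum fun k => w k • Q k, ⟨⟨?_⟩, ?_, ?_⟩, ?_⟩
  · have := fun k => (hQ k).1
    simp [Measure.sum_apply _ MeasurableSet.univ, hw]
  · rw [hmap _ measurable_fst]
    simp only [(hQ _).2.1]
  · rw [hmap _ measurable_snd]
    ext s hs
    simp [Measure.sum_apply _ hs, (hQ _).2.2, ENNReal.tsum_mul_right, hw]
  · rw [ae_iff, Measure.sum_apply_of_countable]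
    refine ENNReal.tsum_eq_zero.2 fun k => ?_
    simp only [Measure.smul_apply, ae_iff.1 (hQθ k), smul_zero]

/-- If every distribution of the ambiguity set gives a loss a finite mean, then its worst-case
mean is finite: otherwise a mixture of distributions with exploding means would have infinite
mean. -/
lemma iSup_lintegral_ambiguitySet_lt_top (hΞ : MeasurableSet Ξ) {μ : Measure Ξ}
    [IsProbabilityMeasure μ] {θ : ℝ≥0} {h : Ξ → ℝ≥0∞}
    (hfin : ∀ P ∈ ambiguitySet μ θ, ∫⁻ ξ, h ξ ∂P < ∞) :
    ⨆ P ∈ ambiguitySet μ θ, ∫⁻ ξ, h ξ ∂P < ∞ := by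
  by_contra htop
  have htop : ⨆ P ∈ ambiguitySet μ θ, ∫⁻ ξ, h ξ ∂P = ∞ := not_lt_top_iff.1 htop
  have hex : ∀ k : ℕ, ∃ P ∈ ambiguitySet μ θ, (2 : ℝ≥0∞) ^ (k + 1) ≤ ∫⁻ ξ, h ξ ∂P := by
    intro k
    have hlt : (2 : ℝ≥0∞) ^ (k + 1) < ⨆ P ∈ ambiguitySet μ θ, ∫⁻ ξ, h ξ ∂P := by
      rw [htop]
      exact ENNReal.pow_lt_top ENNReal.ofNat_lt_top
    simp only [lt_iSup_iff] at hlt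
    obtain ⟨P, hP, hlt⟩ := hlt
    exact ⟨P, hP, hlt.le⟩
  choose P hP hPk using hex
  have hw : ∑' k : ℕ, (2⁻¹ : ℝ≥0∞) ^ (k + 1) = 1 := by
    rw [ENNReal.tsum_geometric_add_one, ENNReal.one_sub_inv_two, inv_inv]
    exact ENNReal.inv_mul_cancel (by norm_num) (by norm_num)
  have hmix := hfin _ (sum_smul_mem_ambiguitySet hΞ hP hw)
  rw [lintegral_sum_measure] at hmix
  refine hmix.not_ge ?_
  calc (∞ : ℝ≥0∞) = ∑' _ : ℕ, 1 := (ENNReal.tsum_const_eq_top_of_ne_zero one_ne_zero).symm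
    _ ≤ _ := ENNReal.tsum_le_tsum fun k => by
      rw [lintegral_smul_measure, smul_eq_mul]
      calc (1 : ℝ≥0∞) = (2⁻¹) ^ (k + 1) * 2 ^ (k + 1) := by
            rw [← mul_pow, ENNReal.inv_mul_cancel (by norm_num) (by norm_num), one_pow]
        _ ≤ _ := by gcongr; exact hPk k

end Wasserstein

end DRCCP

namespace DRCCP

/-! ### The conditional value-at-risk of a loss -/

section Loss

variable {S : Type*} [MeasurableSpace S]

/-- Superquantile form of the `CVaR` constraint: if the conditional value-at-risk of `f` at level
`ε` is nonpositive, then `f` has a nonpositive integral over every event of probability at least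
`ε`. To avoid integrability conditions the positive and negative parts are kept apart. -/
lemma setLIntegral_pos_le_neg_of_cvar_nonpos {P : Measure S} [IsProbabilityMeasure P] {f : S → ℝ}
    (hf : Measurable f) {ε : ℝ} (hε : 0 < ε)
    (hcvar : ⨅ β : ℝ, (β : EReal) +
      ((ENNReal.ofReal (1 / ε) * ∫⁻ ξ, ENNReal.ofReal (f ξ - β) ∂P : ℝ≥0∞) : EReal) ≤ 0) :
    ∫⁻ ξ, ENNReal.ofReal (f ξ) ∂P < ∞ ∧
    ∀ A, ENNReal.ofReal ε ≤ P A →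
      ∫⁻ ξ in A, ENNReal.ofReal (f ξ) ∂P ≤ ∫⁻ ξ in A, ENNReal.ofReal (-f ξ) ∂P := by
  -- almost optimal values of `β`
  have hβ : ∀ δ : ℝ, 0 < δ → ∃ β ≤ δ,
      ∫⁻ ξ, ENNReal.ofReal (f ξ - β) ∂P ≤ ENNReal.ofReal (ε * (δ - β)) := by
    intro δ hδ
    have hlt : ⨅ β : ℝ, (β : EReal) +
        ((ENNReal.ofReal (1 / ε) * ∫⁻ ξ, ENNReal.ofReal (f ξ - β) ∂P : ℝ≥0∞) : EReal)
        < (δ : EReal) := hcvar.trans_lt (by exact_mod_cast hδ)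
    obtain ⟨β, hβ⟩ := iInf_lt_iff.1 hlt
    set J := ∫⁻ ξ, ENNReal.ofReal (f ξ - β) ∂P with hJ
    have hJtop : J ≠ ∞ := by
      intro h
      rw [h, ENNReal.mul_top (by simpa using hε)] at hβ
      simp at hβ
    lift J to ℝ≥0 using hJtop with K
    have hcoe : ((ENNReal.ofReal (1 / ε) * (K : ℝ≥0∞) : ℝ≥0∞) : EReal)
        = ((1 / ε * K : ℝ) : EReal) := by
      rw [← ENNReal.ofReal_coe_nnreal, ← ENNReal.ofReal_mul (by positivity),
        EReal.coe_ennreal_ofReal, max_eq_left (by positivity)]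
    rw [hcoe] at hβ
    have hβ : β + 1 / ε * K < δ := by exact_mod_cast hβ
    have h0 : 0 ≤ 1 / ε * (K : ℝ) := by positivity
    have hK : (K : ℝ) ≤ ε * (δ - β) := by
      calc (K : ℝ) = ε * (1 / ε * K) := by field_simp
        _ ≤ _ := by gcongr; linarith
    refine ⟨β, by linarith, ?_⟩
    rw [← hJ, ← ENNReal.ofReal_coe_nnreal]
    exact ENNReal.ofReal_le_ofReal hK
  have hfpos : Measurable fun ξ => ENNReal.ofReal (f ξ) := hf.ennreal_ofReal
  constructor
  · obtain ⟨β, -, hβ⟩ := hβ 1 one_pos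
    calc ∫⁻ ξ, ENNReal.ofReal (f ξ) ∂P
        ≤ ∫⁻ ξ, ENNReal.ofReal (f ξ - β) + ENNReal.ofReal β ∂P := lintegral_mono fun ξ => by
          simpa using ENNReal.ofReal_add_le (p := f ξ - β) (q := β)
      _ = ∫⁻ ξ, ENNReal.ofReal (f ξ - β) ∂P + ENNReal.ofReal β := by
          rw [lintegral_add_right _ measurable_const, lintegral_const, measure_univ, mul_one]
      _ < ∞ := ENNReal.add_lt_top.2 ⟨hβ.trans_lt ENNReal.ofReal_lt_top, ENNReal.ofReal_lt_top⟩
  · intro A hA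
    refine ENNReal.le_of_forall_pos_le_add fun δ hδ _ => ?_
    obtain ⟨β, hβδ, hβ⟩ := hβ δ hδ
    -- `f⁺ - f⁻ = f ≤ (f - β)⁺ + β`, with all negative terms moved to the other side
    have hpt : ∀ ξ, ENNReal.ofReal (f ξ) + ENNReal.ofReal (δ - β) ≤
        ENNReal.ofReal (f ξ - β) + (ENNReal.ofReal (-f ξ) + δ) := by
      intro ξ
      rw [← ENNReal.ofReal_coe_nnreal (p := δ)]
      simp only [ENNReal.ofReal, ← ENNReal.coe_add, ENNReal.coe_le_coe, ← NNReal.coe_le_coe,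
        NNReal.coe_add, Real.coe_toNNReal']
      rw [max_eq_left (sub_nonneg.2 hβδ), max_eq_left (show (0 : ℝ) ≤ (δ : ℝ) from δ.2)]
      have h1 := le_max_left (f ξ - β) 0
      have h2 := le_max_left (-f ξ) 0
      have h3 := le_max_right (f ξ - β) 0
      rcases max_cases (f ξ) 0 with ⟨h, h'⟩ | ⟨h, h'⟩ <;> rw [h] <;>
        [skip; rcases max_cases (-f ξ) 0 with ⟨h4, h4'⟩ | ⟨h4, h4'⟩] <;>
        linarith [le_max_right (-f ξ) 0]
    have hint := lintegral_mono (μ := P.restrict A) hpt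
    rw [lintegral_add_left hfpos, lintegral_add_left (by fun_prop),
      lintegral_add_right _ measurable_const, lintegral_const, lintegral_const,
      Measure.restrict_apply_univ] at hint
    have hmass : ENNReal.ofReal (ε * (δ - β)) ≤ ENNReal.ofReal (δ - β) * P A := by
      rw [mul_comm, ENNReal.ofReal_mul (sub_nonneg.2 hβδ)]
      gcongr
    have hδA : (δ : ℝ≥0∞) * P A ≤ δ := mul_le_of_le_one_right' prob_le_one
    refine (ENNReal.add_le_add_iff_right (a := ENNReal.ofReal (ε * (δ - β)))
      ENNReal.ofReal_ne_top).1 ?_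
    calc ∫⁻ ξ in A, ENNReal.ofReal (f ξ) ∂P + ENNReal.ofReal (ε * (δ - β))
        ≤ ∫⁻ ξ in A, ENNReal.ofReal (f ξ) ∂P + ENNReal.ofReal (δ - β) * P A := by gcongr
      _ ≤ _ := hint
      _ ≤ ENNReal.ofReal (ε * (δ - β)) + (∫⁻ ξ in A, ENNReal.ofReal (-f ξ) ∂P + δ) := by
          gcongr
          exact (setLIntegral_le_lintegral _ _).trans hβ
      _ = _ := add_comm _ _

end Loss

/-! ### The maximum of the constraint functions -/

section MaxLoss

variable {S ι E : Type*} [Fintype ι] [Nonempty ι]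

/-- The pointwise maximum of finitely many constraint functions. -/
def maxLoss (g : ι → E → S → ℝ) (x : E) (ξ : S) : ℝ :=
  Finset.univ.sup' Finset.univ_nonempty fun i => g i x ξ

lemma maxLoss_le_iff {g : ι → E → S → ℝ} {x : E} {ξ : S} {r : ℝ} :
    maxLoss g x ξ ≤ r ↔ ∀ i, g i x ξ ≤ r := by
  simp [maxLoss]

lemma measurable_maxLoss [MeasurableSpace S] {g : ι → E → S → ℝ}
    (hg : ∀ i x, Measurable (g i x)) (x : E) : Measurable (maxLoss g x) := by
  have h : maxLoss g x = Finset.univ.sup' Finset.univ_nonempty fun i => g i x := by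
    funext ξ
    rw [Finset.sup'_apply]
    rfl
  rw [h]
  exact Finset.measurable_sup' _ fun i _ => hg i x

lemma iSup_ofReal_sub (g : ι → E → S → ℝ) (x : E) (ξ : S) (β : ℝ) :
    ⨆ i, ENNReal.ofReal (g i x ξ - β) = ENNReal.ofReal (maxLoss g x ξ - β) := by
  apply le_antisymm
  · refine iSup_le fun i => ENNReal.ofReal_le_ofReal ?_
    gcongr
    exact maxLoss_le_iff.1 le_rfl i
  · obtain ⟨i, -, hi⟩ := Finset.exists_mem_eq_sup' (Finset.univ_nonempty (α := ι))
      (fun i => g i x ξ)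
    rw [maxLoss, hi]
    exact le_iSup (fun i => ENNReal.ofReal (g i x ξ - β)) i

lemma iSup_ofReal (g : ι → E → S → ℝ) (x : E) (ξ : S) :
    ⨆ i, ENNReal.ofReal (g i x ξ) = ENNReal.ofReal (maxLoss g x ξ) := by
  simpa using iSup_ofReal_sub g x ξ 0

lemma convexOn_maxLoss [AddCommGroup E] [Module ℝ E] {g : ι → E → S → ℝ} {ξ : S}
    (hg : ∀ i, ConvexOn ℝ univ fun x => g i x ξ) : ConvexOn ℝ univ fun x => maxLoss g x ξ := by
  refine ⟨convex_univ, fun x _ y _ a b ha hb hab => maxLoss_le_iff.2 fun i => ?_⟩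
  refine ((hg i).2 (mem_univ x) (mem_univ y) ha hb hab).trans ?_
  simp only [smul_eq_mul]
  gcongr
  exacts [maxLoss_le_iff.1 le_rfl i, maxLoss_le_iff.1 le_rfl i]

lemma lowerSemicontinuous_maxLoss [TopologicalSpace E] {g : ι → E → S → ℝ} {ξ : S}
    (hg : ∀ i, LowerSemicontinuous fun x => g i x ξ) :
    LowerSemicontinuous fun x => maxLoss g x ξ := by
  intro x y hy
  obtain ⟨i, -, hi⟩ := (Finset.lt_sup'_iff _).1 hy
  filter_upwards [hg i x y hi] with z hz
  exact (Finset.lt_sup'_iff _).2 ⟨i, Finset.mem_univ i, hz⟩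

end MaxLoss

/-! ### The worst-case hinge loss and its minimizers -/

section Programs

variable {n : ℕ} {S ι : Type*} [MeasurableSpace S] [Fintype ι] [Nonempty ι]
  {g : ι → EuclideanSpace ℝ (Fin n) → S → ℝ} {𝒜 : Set (Measure S)}

lemma worstHinge_eq (x : EuclideanSpace ℝ (Fin n)) :
    worstHinge g 𝒜 x = ⨆ P ∈ 𝒜, ∫⁻ ξ, ENNReal.ofReal (maxLoss g x ξ) ∂P := by
  simp only [worstHinge, iSup_ofReal]

lemma lowerSemicontinuous_worstHinge (hg : ∀ i x, Measurable (g i x))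
    (hlsc : ∀ P ∈ 𝒜, ∀ᵐ ξ ∂P, ∀ i, LowerSemicontinuous fun x => g i x ξ) :
    LowerSemicontinuous (worstHinge g 𝒜) := by
  refine lowerSemicontinuous_biSup fun P hP => lowerSemicontinuous_iff_le_liminf.2 fun x => ?_
  simp only [iSup_ofReal]
  calc ∫⁻ ξ, ENNReal.ofReal (maxLoss g x ξ) ∂P
      ≤ ∫⁻ ξ, liminf (fun y => ENNReal.ofReal (maxLoss g y ξ)) (𝓝 x) ∂P := by
        refine lintegral_mono_ae ?_
        filter_upwards [hlsc P hP] with ξ hξ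
        exact (ENNReal.continuous_ofReal.comp_lowerSemicontinuous (lowerSemicontinuous_maxLoss hξ)
          ENNReal.ofReal_mono).le_liminf x
    _ ≤ _ := lintegral_liminf_le fun y => (measurable_maxLoss hg y).ennreal_ofReal

/-- A cost vector in the interior of the dual cone grows at least linearly on the cone. -/
lemma exists_mul_norm_le_inner {E : Type*} [NormedAddCommGroup E] [InnerProductSpace ℝ E]
    [CompleteSpace E] (C : ProperCone ℝ E) {c : E}
    (hc : c ∈ interior (ProperCone.innerDual (C : Set E) : Set E)) :
    ∃ r > 0, ∀ x ∈ C, r * ‖x‖ ≤ inner ℝ c x := by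
  obtain ⟨r, hr, hball⟩ := Metric.mem_nhds_iff.1 (mem_interior_iff_mem_nhds.1 hc)
  refine ⟨r / 2, half_pos hr, fun x hx => ?_⟩
  rcases eq_or_ne x 0 with rfl | hx0
  · simp
  have hx0' : 0 < ‖x‖ := norm_pos_iff.2 hx0
  have hmem : c - (r / 2 / ‖x‖) • x ∈ Metric.ball c r := by
    rw [mem_ball_iff_norm, sub_sub_cancel_left, norm_neg, norm_smul, Real.norm_of_nonneg
      (by positivity), div_mul_cancel₀ _ hx0'.ne']
    exact half_lt_self hr
  have hin : 0 ≤ inner ℝ x (c - (r / 2 / ‖x‖) • x) :=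
    ProperCone.mem_innerDual.1 (hball hmem) hx
  rw [inner_sub_right, inner_smul_right, real_inner_self_eq_norm_sq, real_inner_comm] at hin
  have : r / 2 / ‖x‖ * ‖x‖ ^ 2 = r / 2 * ‖x‖ := by field_simp
  linarith

lemma hingeArgmin_nonempty (hg : ∀ i x, Measurable (g i x))
    (hlsc : ∀ P ∈ 𝒜, ∀ᵐ ξ ∂P, ∀ i, LowerSemicontinuous fun x => g i x ξ)
    {C : ProperCone ℝ (EuclideanSpace ℝ (Fin n))} {X : Set (EuclideanSpace ℝ (Fin n))}
    (hX_closed : IsClosed X) (hXC : X ⊆ (C : Set (EuclideanSpace ℝ (Fin n))))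
    {c : EuclideanSpace ℝ (Fin n)}
    (hc : c ∈ interior (ProperCone.innerDual (C : Set (EuclideanSpace ℝ (Fin n))) :
        Set (EuclideanSpace ℝ (Fin n))))
    {x₀ : EuclideanSpace ℝ (Fin n)} (hx₀ : x₀ ∈ X) {t : ℝ} (ht : inner ℝ c x₀ ≤ t) :
    (hingeArgmin g 𝒜 X c t).Nonempty := by
  obtain ⟨r, hr, hC⟩ := exists_mul_norm_le_inner C hc
  have hcompact : IsCompact (X ∩ {x | inner ℝ c x ≤ t}) := by
    refine (isCompact_closedBall (0 : EuclideanSpace ℝ (Fin n)) (t / r)).of_isClosed_subset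
      (hX_closed.inter (isClosed_le (by fun_prop) continuous_const)) fun x hx => ?_
    rw [mem_closedBall_zero_iff, le_div_iff₀ hr, mul_comm]
    exact (hC x (hXC hx.1)).trans hx.2
  obtain ⟨x, hx, hmin⟩ := LowerSemicontinuousOn.exists_isMinOn
    (show (X ∩ {x | inner ℝ c x ≤ t}).Nonempty from ⟨x₀, hx₀, ht⟩) hcompact
    ((lowerSemicontinuous_worstHinge hg hlsc).lowerSemicontinuousOn _)
  exact ⟨x, hx.1, hx.2, fun y hy hyt => hmin ⟨hy, hyt⟩⟩

/-- Along the segment from `x` to `y` the loss stays positive with probability close to that of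
its being positive at `x`, by lower semicontinuity. -/
lemma exists_segment_measure_pos_gt (hg : ∀ i x, Measurable (g i x)) {P : Measure S}
    (hlsc : ∀ᵐ ξ ∂P, ∀ i, LowerSemicontinuous fun x => g i x ξ)
    {x y : EuclideanSpace ℝ (Fin n)} {a : ℝ≥0∞} (ha : a < P {ξ | 0 < maxLoss g x ξ}) :
    ∃ l ∈ Ioo (0 : ℝ) 1, a < P {ξ | 0 < maxLoss g ((1 - l) • x + l • y) ξ} := by
  have hmeas : ∀ z, MeasurableSet {ξ | 0 < maxLoss g z ξ} := fun z =>
    measurableSet_lt measurable_const (measurable_maxLoss hg z)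
  have hind : LowerSemicontinuous fun z => P {ξ | 0 < maxLoss g z ξ} := by
    refine lowerSemicontinuous_iff_le_liminf.2 fun z => ?_
    simp only [← lintegral_indicator_one (hmeas _)]
    refine le_trans (lintegral_mono_ae ?_)
      (lintegral_liminf_le fun z => measurable_one.indicator (hmeas z))
    filter_upwards [hlsc] with ξ hξ
    by_cases hz : 0 < maxLoss g z ξ
    · refine le_liminf_of_le (by isBoundedDefault) ?_
      filter_upwards [lowerSemicontinuous_maxLoss hξ z 0 hz] with w hw
      simp [indicator, hz, hw]
    · simp [indicator, hz]
  have hcont : Continuous fun l : ℝ => (1 - l) • x + l • y := by fun_prop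
  have hev : ∀ᶠ l : ℝ in 𝓝[>] 0, a < P {ξ | 0 < maxLoss g ((1 - l) • x + l • y) ξ} :=
    ((hcont.tendsto 0).eventually (hind _ a (by simpa using ha))).filter_mono nhdsWithin_le_nhds
  obtain ⟨l, hl, hl'⟩ := (hev.and (Ioo_mem_nhdsGT one_pos)).exists
  exact ⟨l, hl', hl⟩

/-- Convexity step: if `y` satisfies the `CVaR` constraint and the loss at a point
of the segment from `x` to `y` is positive with probability at least `ε`, then the hinge loss
there is at most `1 - l` times the one at `x`. Indeed, on the event where the loss is positive the
term of `y` in the convexity bound has a nonpositive integral. -/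
lemma lintegral_maxLoss_segment_le (hg : ∀ i x, Measurable (g i x)) {P : Measure S}
    [IsProbabilityMeasure P] (hconv : ∀ᵐ ξ ∂P, ∀ i, ConvexOn ℝ univ fun x => g i x ξ)
    {x y : EuclideanSpace ℝ (Fin n)} {ε : ℝ} (hε : 0 < ε)
    (hcvar : ⨅ β : ℝ, (β : EReal) +
      ((ENNReal.ofReal (1 / ε) * ∫⁻ ξ, ENNReal.ofReal (maxLoss g y ξ - β) ∂P : ℝ≥0∞) : EReal) ≤ 0)
    {l : ℝ} (hl : l ∈ Ioo (0 : ℝ) 1)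
    (hpos : ENNReal.ofReal ε ≤ P {ξ | 0 < maxLoss g ((1 - l) • x + l • y) ξ}) :
    ∫⁻ ξ, ENNReal.ofReal (maxLoss g ((1 - l) • x + l • y) ξ) ∂P ≤
      ENNReal.ofReal (1 - l) * ∫⁻ ξ, ENNReal.ofReal (maxLoss g x ξ) ∂P := by
  set z := (1 - l) • x + l • y
  set A := {ξ | 0 < maxLoss g z ξ} with hA
  have hAm : MeasurableSet A := measurableSet_lt measurable_const (measurable_maxLoss hg z)
  obtain ⟨hfin, htail⟩ := setLIntegral_pos_le_neg_of_cvar_nonpos (measurable_maxLoss hg y) hε hcvar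
  have hmx := (measurable_maxLoss hg x).ennreal_ofReal
  have hmy := (measurable_maxLoss hg y).ennreal_ofReal
  have hmy' : Measurable fun ξ => ENNReal.ofReal (-maxLoss g y ξ) :=
    (measurable_maxLoss hg y).neg.ennreal_ofReal
  have hmz := (measurable_maxLoss hg z).ennreal_ofReal
  have hpt : ∀ᵐ ξ ∂(P.restrict A),
      ENNReal.ofReal (maxLoss g z ξ) + ENNReal.ofReal l * ENNReal.ofReal (-maxLoss g y ξ) ≤
      ENNReal.ofReal (1 - l) * ENNReal.ofReal (maxLoss g x ξ) +
        ENNReal.ofReal l * ENNReal.ofReal (maxLoss g y ξ) := by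
    filter_upwards [ae_restrict_of_ae hconv, ae_restrict_mem hAm] with ξ hξ hξA
    have hc := (convexOn_maxLoss hξ).2 (mem_univ x) (mem_univ y) (sub_nonneg.2 hl.2.le) hl.1.le
      (sub_add_cancel 1 l)
    simp only [smul_eq_mul] at hc
    simp only [ENNReal.ofReal, ← ENNReal.coe_mul, ← ENNReal.coe_add, ENNReal.coe_le_coe,
      ← NNReal.coe_le_coe, NNReal.coe_add, NNReal.coe_mul, Real.coe_toNNReal']
    rw [max_eq_left (le_of_lt hξA), max_eq_left hl.1.le, max_eq_left (sub_nonneg.2 hl.2.le)]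
    have hx := mul_le_mul_of_nonneg_left (le_max_left (maxLoss g x ξ) 0) (sub_nonneg.2 hl.2.le)
    have hy : max (maxLoss g y ξ) 0 - max (-maxLoss g y ξ) 0 = maxLoss g y ξ := by
      rcases max_cases (maxLoss g y ξ) 0 with ⟨h, h'⟩ | ⟨h, h'⟩ <;>
        rcases max_cases (-maxLoss g y ξ) 0 with ⟨h2, h2'⟩ | ⟨h2, h2'⟩ <;> rw [h, h2] <;> linarith
    have hy' := congrArg (l * ·) hy
    simp only [mul_sub] at hy'
    linarith
  have hint := lintegral_mono_ae hpt
  rw [lintegral_add_left hmz, lintegral_add_left (hmx.const_mul _), lintegral_const_mul _ hmy',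
    lintegral_const_mul _ hmx, lintegral_const_mul _ hmy] at hint
  have hsupp : ∫⁻ ξ in A, ENNReal.ofReal (maxLoss g z ξ) ∂P =
      ∫⁻ ξ, ENNReal.ofReal (maxLoss g z ξ) ∂P := by
    refine setLIntegral_eq_of_support_subset fun ξ hξ => ?_
    simpa [hA] using hξ
  have hfinA : ENNReal.ofReal l * ∫⁻ ξ in A, ENNReal.ofReal (maxLoss g y ξ) ∂P ≠ ∞ :=
    ENNReal.mul_ne_top ENNReal.ofReal_ne_top ((setLIntegral_le_lintegral _ _).trans_lt hfin).ne
  rw [← hsupp]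
  refine (ENNReal.add_le_add_iff_right hfinA).1 ?_
  calc _ ≤ ∫⁻ ξ in A, ENNReal.ofReal (maxLoss g z ξ) ∂P +
          ENNReal.ofReal l * ∫⁻ ξ in A, ENNReal.ofReal (-maxLoss g y ξ) ∂P := by
        exact add_le_add le_rfl (mul_le_mul' le_rfl (htail A hpos))
    _ ≤ _ := hint
    _ ≤ _ := by
        exact add_le_add (mul_le_mul' le_rfl (setLIntegral_le_lintegral _ _)) le_rfl

end Programs

end DRCCP

namespace DRCCP

/-! ### Comparison of ALSO-X with the conditional value-at-risk -/

section Comparison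

variable {F : Type*} [NormedAddCommGroup F] [NormedSpace ℝ F] [FiniteDimensional ℝ F]
  [MeasurableSpace F] [BorelSpace F] {Ξ : Set F} {n : ℕ} {ι : Type*} [Fintype ι] [Nonempty ι]
  {g : ι → EuclideanSpace ℝ (Fin n) → Ξ → ℝ}

/-- Every minimizer of the worst-case hinge loss, over a set containing a point that satisfies the
worst-case `CVaR` constraint, satisfies the robust chance constraint. -/
lemma robustChance_of_mem_hingeArgmin (hΞ : MeasurableSet Ξ) (hg : ∀ i x, Measurable (g i x))
    {μ : Measure Ξ} [IsProbabilityMeasure μ] {θ : ℝ≥0}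
    (hg_conv : ∀ P ∈ ambiguitySet μ θ, ∀ᵐ ξ ∂P, ∀ i,
      ConvexOn ℝ univ (fun x => g i x ξ) ∧ LowerSemicontinuous (fun x => g i x ξ))
    {X : Set (EuclideanSpace ℝ (Fin n))} (hX_conv : Convex ℝ X)
    {c : EuclideanSpace ℝ (Fin n)} {ε : ℝ} (hε : ε ∈ Ioo (0 : ℝ) 1) {t : ℝ}
    {x y : EuclideanSpace ℝ (Fin n)} (hx : x ∈ hingeArgmin g (ambiguitySet μ θ) X c t)
    (hy : y ∈ X) (hyt : inner ℝ c y ≤ t) (hcvar : worstCVaR g (ambiguitySet μ θ) ε y ≤ 0) :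
    RobustChance g (ambiguitySet μ θ) ε x := by
  have hmeas : ∀ z, MeasurableSet {ξ | 0 < maxLoss g z ξ} := fun z =>
    measurableSet_lt measurable_const (measurable_maxLoss hg z)
  have hcvar' : ∀ P ∈ ambiguitySet μ θ, ⨅ β : ℝ, (β : EReal) +
      ((ENNReal.ofReal (1 / ε) * ∫⁻ ξ, ENNReal.ofReal (maxLoss g y ξ - β) ∂P : ℝ≥0∞) : EReal)
      ≤ 0 := by
    intro P hP
    simp only [worstCVaR, iSup_ofReal_sub] at hcvar
    exact iSup₂_le_iff.1 hcvar P hP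
  refine le_iInf₂ fun P₀ hP₀ => ?_
  by_contra! hlt
  have := hP₀.1
  have hviol : ENNReal.ofReal ε < P₀ {ξ | 0 < maxLoss g x ξ} := by
    have hset : {ξ | ∀ i, g i x ξ ≤ 0} = {ξ | 0 < maxLoss g x ξ}ᶜ := by
      ext ξ
      simp [← maxLoss_le_iff]
    rw [hset, prob_compl_eq_one_sub (hmeas x), ENNReal.ofReal_sub _ hε.1.le,
      ENNReal.ofReal_one] at hlt
    by_contra! h
    exact hlt.not_ge (tsub_le_tsub_left h 1)
  -- the optimal hinge loss is finite, and positive since `x` violates the constraints under `P₀`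
  have hfin : worstHinge g (ambiguitySet μ θ) x ≠ ∞ := by
    refine ((hx.2.2 y hy hyt).trans_lt ?_).ne
    rw [worstHinge_eq]
    refine iSup_lintegral_ambiguitySet_lt_top hΞ fun P hP => ?_
    have := hP.1
    exact (setLIntegral_pos_le_neg_of_cvar_nonpos (measurable_maxLoss hg y) hε.1 (hcvar' P hP)).1
  have hpos : worstHinge g (ambiguitySet μ θ) x ≠ 0 := by
    intro h0
    rw [worstHinge_eq] at h0
    have h0' : ∫⁻ ξ, ENNReal.ofReal (maxLoss g x ξ) ∂P₀ = 0 :=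
      le_antisymm (h0 ▸ le_iSup₂ (f := fun P (_ : P ∈ ambiguitySet μ θ) =>
        ∫⁻ ξ, ENNReal.ofReal (maxLoss g x ξ) ∂P) P₀ hP₀) bot_le
    rw [lintegral_eq_zero_iff (measurable_maxLoss hg x).ennreal_ofReal] at h0'
    have hnull : P₀ {ξ | 0 < maxLoss g x ξ} = 0 := by
      rw [← compl_compl {ξ | 0 < maxLoss g x ξ}]
      refine mem_ae_iff.1 (h0'.mono fun ξ hξ => ?_)
      simpa using hξ
    rw [hnull] at hviol
    exact not_lt_bot hviol
  obtain ⟨l, hl, hlviol⟩ := exists_segment_measure_pos_gt (y := y) hg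
    ((hg_conv P₀ hP₀).mono fun ξ hξ i => (hξ i).2) hviol
  set z := (1 - l) • x + l • y with hz
  have hl0 : 0 ≤ 1 - l := sub_nonneg.2 hl.2.le
  have hzX : z ∈ X := hX_conv hx.1 hy hl0 hl.1.le (sub_add_cancel 1 l)
  have hzt : inner ℝ c z ≤ t := by
    rw [hz, inner_add_right, inner_smul_right, inner_smul_right]
    calc _ ≤ (1 - l) * t + l * t :=
          add_le_add (mul_le_mul_of_nonneg_left hx.2.1 hl0)
            (mul_le_mul_of_nonneg_left hyt hl.1.le)
      _ = t := by ring
  -- `P₁` nearly attains the worst-case hinge loss at `z`, with an error that convexity beats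
  have hgap : ENNReal.ofReal (1 - l) * worstHinge g (ambiguitySet μ θ) x <
      worstHinge g (ambiguitySet μ θ) z := by
    refine lt_of_lt_of_le ?_ (hx.2.2 z hzX hzt)
    conv_rhs => rw [← one_mul (worstHinge g (ambiguitySet μ θ) x)]
    refine (ENNReal.mul_lt_mul_iff_left hpos hfin).2 ?_
    rw [← ENNReal.ofReal_one]
    exact (ENNReal.ofReal_lt_ofReal_iff one_pos).2 (by linarith [hl.1])
  rw [worstHinge_eq z] at hgap
  simp only [lt_iSup_iff] at hgap
  obtain ⟨P₁, hP₁, hgap⟩ := hgap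
  -- glued with `P₀`, it also violates the constraints at `z` with probability above `ε`
  obtain ⟨P, hP, hdom⟩ :=
    exists_mem_ambiguitySet_dominating hΞ hP₁ hP₀ (measurable_maxLoss hg z)
  have hPviol : ENNReal.ofReal ε ≤ P {ξ | 0 < maxLoss g z ξ} := by
    have hφ : Monotone ((Ioi (0 : ℝ)).indicator (1 : ℝ → ℝ≥0∞)) := by
      intro a b hab
      by_cases ha : 0 < a
      · simp [ha, ha.trans_le hab]
      · simp [ha]
    have hint : ∀ Q : Measure Ξ, ∫⁻ ξ, (Ioi (0 : ℝ)).indicator (1 : ℝ → ℝ≥0∞) (maxLoss g z ξ) ∂Q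
        = Q {ξ | 0 < maxLoss g z ξ} := fun Q => lintegral_indicator_one (hmeas z)
    have h := (hdom _ hφ).2
    rw [hint, hint] at h
    exact hlviol.le.trans h
  have := hP.1
  refine (hgap.trans_le (hdom _ ENNReal.ofReal_mono).1).not_ge ?_
  refine (lintegral_maxLoss_segment_le hg ((hg_conv P hP).mono fun ξ hξ i => (hξ i).1) hε.1
    (hcvar' P hP) hl hPviol).trans ?_
  rw [worstHinge_eq]
  gcongr
  exact le_iSup₂ (f := fun P (_ : P ∈ ambiguitySet μ θ) =>
    ∫⁻ ξ, ENNReal.ofReal (maxLoss g x ξ) ∂P) P hP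

end Comparison

end DRCCP

theorem mainTheorem6 {n : ℕ}
    -- `F` is `ℝᵐ` with an arbitrary norm, the norm of the Wasserstein distance
    {F : Type*} [NormedAddCommGroup F] [NormedSpace ℝ F] [FiniteDimensional ℝ F]
    [MeasurableSpace F] [BorelSpace F]
    {ι : Type*} [Fintype ι] [Nonempty ι]
    -- the support set and the constraint functions
    (Ξ : Set F) (hΞ : MeasurableSet Ξ)
    (g : ι → EuclideanSpace ℝ (Fin n) → Ξ → ℝ)
    (hg_meas : ∀ i x, Measurable (g i x))
    -- the reference distribution and the Wasserstein radius
    (μ : Measure Ξ) [IsProbabilityMeasure μ] (hμ : DRCCP.IsSubGaussian μ) (θ : ℝ≥0)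
    (hg_conv : ∀ P ∈ DRCCP.ambiguitySet μ θ, ∀ᵐ ξ ∂P, ∀ i,
      ConvexOn ℝ univ (fun x => g i x ξ) ∧ LowerSemicontinuous (fun x => g i x ξ))
    -- the deterministic feasible set, contained in a closed pointed convex cone
    (C : ProperCone ℝ (EuclideanSpace ℝ (Fin n))) (hC : ∀ x ∈ C, x ≠ 0 → -x ∉ C)
    (X : Set (EuclideanSpace ℝ (Fin n))) (hX_ne : X.Nonempty) (hX_closed : IsClosed X)
    (hX_conv : Convex ℝ X) (hXC : X ⊆ (C : Set (EuclideanSpace ℝ (Fin n))))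
    -- the cost vector; in the degenerate case `c = 0` the lower-level problem is to have a solution
    (c : EuclideanSpace ℝ (Fin n))
    (hc : c ∈ interior (ProperCone.innerDual (C : Set (EuclideanSpace ℝ (Fin n))) :
        Set (EuclideanSpace ℝ (Fin n))) ∨
      (c = 0 ∧ (DRCCP.hingeArgmin g (DRCCP.ambiguitySet μ θ) X c 0).Nonempty))
    -- the risk level
    (ε : ℝ) (hε : ε ∈ Ioo (0 : ℝ) 1) :
    DRCCP.worstALSOX g (DRCCP.ambiguitySet μ θ) X c ε ≤
      DRCCP.worstCVaRValue g (DRCCP.ambiguitySet μ θ) X c ε := by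
  refine le_iInf₂ fun y hy => le_iInf fun hcvar => ?_
  have hlsc : ∀ P ∈ DRCCP.ambiguitySet μ θ, ∀ᵐ ξ ∂P, ∀ i,
      LowerSemicontinuous fun x => g i x ξ :=
    fun P hP => (hg_conv P hP).mono fun ξ hξ i => (hξ i).2
  have hne : (DRCCP.hingeArgmin g (DRCCP.ambiguitySet μ θ) X c (inner ℝ c y)).Nonempty := by
    rcases hc with hc | ⟨rfl, hc⟩
    · exact DRCCP.hingeArgmin_nonempty hg_meas hlsc hX_closed hXC hc hy le_rfl
    · simpa using hc
  obtain ⟨x, hx⟩ := hne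
  exact iInf₂_le_of_le (inner ℝ c y) ⟨x, hx, DRCCP.robustChance_of_mem_hingeArgmin hΞ hg_meas
    hg_conv hX_conv hε hx hy le_rfl hcvar⟩ le_rfl
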